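/- Let $G$ be a finitely generated group acting by isometries on a proper geodesic metric space $X$ (closed balls of $X$ are compact and any two points are joined by a geodesic segment), and suppose that the action is proper: for every compact $K\subseteq X$ the set $\{g\in G : gK\cap K\neq\emptyset\}$ is finite. Let $H\le G$ be a finitely generated subgroup, equipped with a word metric of a finite generating set. Terminology. A map $\phi:Y\to X$ of metric spaces is a $(\kappa,\lambda)$-quasi-isometric embedding, where $\kappa\ge 1$ and $\lambda>0$, if $\frac1\kappa d(a,b)-\lambda\le d(\phi(a),\phi(b))\le\kappa\, d(a,b)+\lambda$ for all $a,b\in Y$, and it is a quasi-isometric embedding if this holds for some $\kappa\ge1$ and $\lambda>0$. A $\kappa$-quasigeodesic is a $(\kappa,\kappa)$-quasi-isometric embedding of an interval (it need not be continuous). A subset $Y\subseteq X$ of a metric space has the *stability property* if for every $\kappa>1$ there is $D>0$ such that any two $\kappa$-quasigeodesics in $X$, defined on compact intervals and having the same endpoints $a,b\in Y$, have images each contained in the $D$-neighborhood of the other. A *stable embedding* is a quasi-isometric embedding whose image has the stability property. A subgroup $H\le G$ is *stable in $G$* if $H$ is finitely generated and, for all word metrics on $G$ and on $H$ coming from finite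 generating sets, the inclusion $H\to G$ is a quasi-isometric embedding and the subset $H\subseteq G$ has the stability property in $G$ with its word metric. Theorem. If for some $x\in X$ the orbit map $G\to X$, $g\mapsto gx$, restricts to a stable embedding $H\to X$, then $H$ is stable in $G$. -/

import Mathlib

/-! ### Maps between metric spaces, quasigeodesics, stability -/

/-- A metric space is geodesic if any two points `x`, `y` are joined by an isometrically embedded
copy of the interval `[0, d(x,y)]`. -/
def IsGeodesicMetricSpace (X : Type*) [MetricSpace X] : Prop :=
  ∀ x y : X, ∃ γ : ℝ → X, γ 0 = x ∧ γ (dist x y) = y ∧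
    ∀ s ∈ Set.Icc (0 : ℝ) (dist x y), ∀ t ∈ Set.Icc (0 : ℝ) (dist x y),
      dist (γ s) (γ t) = |s - t|

/-- `φ` is a `(κ, lam)`-quasi-isometric embedding. -/
def IsQIEmbeddingWith {Y X : Type*} [MetricSpace Y] [MetricSpace X] (κ lam : ℝ) (φ : Y → X) :
    Prop :=
  ∀ a b : Y, (1 / κ) * dist a b - lam ≤ dist (φ a) (φ b) ∧
    dist (φ a) (φ b) ≤ κ * dist a b + lam

/-- `φ` is a quasi-isometric embedding. -/
def IsQIEmbedding {Y X : Type*} [MetricSpace Y] [MetricSpace X] (φ : Y → X) : Prop :=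
  ∃ κ lam : ℝ, 1 ≤ κ ∧ 0 < lam ∧ IsQIEmbeddingWith κ lam φ

/-- `q`, restricted to the compact interval `[s, t]`, is a `κ`-quasigeodesic in `X` from `a` to
`b`, that is, a (not necessarily continuous) `(κ, κ)`-quasi-isometric embedding of `[s, t]` which
sends `s` to `a` and `t` to `b`. -/
def IsQuasigeodesicBetween {X : Type*} [MetricSpace X] (κ : ℝ) (s t : ℝ) (q : ℝ → X)
    (a b : X) : Prop :=
  s ≤ t ∧ q s = a ∧ q t = b ∧ IsQIEmbeddingWith κ κ (fun u : Set.Icc s t => q u)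

/-- `A` and `B` are `D`-Hausdorff close: each lies in the `D`-neighborhood of the other. -/
def HausdorffClose {X : Type*} [MetricSpace X] (D : ℝ) (A B : Set X) : Prop :=
  A ⊆ Metric.thickening D B ∧ B ⊆ Metric.thickening D A

/-- The defining property of a stable subset: for every `κ > 1` there is `D > 0` such that any two
`κ`-quasigeodesics of `X` with the same endpoints in `Y` are `D`-Hausdorff close. -/
def IsStableSubset {X : Type*} [MetricSpace X] (Y : Set X) : Prop :=
  ∀ κ : ℝ, 1 < κ → ∃ D : ℝ, 0 < D ∧
    ∀ a ∈ Y, ∀ b ∈ Y, ∀ (s t : ℝ) (q : ℝ → X) (s' t' : ℝ) (q' : ℝ → X),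
      IsQuasigeodesicBetween κ s t q a b → IsQuasigeodesicBetween κ s' t' q' a b →
        HausdorffClose D (q '' Set.Icc s t) (q' '' Set.Icc s' t')

/-- A stable embedding: a quasi-isometric embedding whose image is stable. -/
def IsStableEmbedding {Y X : Type*} [MetricSpace Y] [MetricSpace X] (φ : Y → X) : Prop :=
  IsQIEmbedding φ ∧ IsStableSubset (Set.range φ)

/-! ### Word metrics -/

/-- A finite generating set of a group (not assumed symmetric). -/
structure FiniteGeneratingSet (G : Type*) [Group G] where
  carrier : Finset G
  closure_eq_top : Subgroup.closure (carrier : Set G) = ⊤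

/-- `l` is a word in the elements of `S` and their inverses which represents `g`. -/
def IsWordFor {G : Type*} [Group G] (S : FiniteGeneratingSet G) (g : G) (l : List G) : Prop :=
  (∀ a ∈ l, a ∈ S.carrier ∨ a⁻¹ ∈ S.carrier) ∧ l.prod = g

/-- The word norm of `g`: the least length of a word representing `g`. -/
noncomputable def wordNorm {G : Type*} [Group G] (S : FiniteGeneratingSet G) (g : G) : ℕ :=
  sInf {n : ℕ | ∃ l : List G, IsWordFor S g l ∧ l.length = n}

theorem exists_word_length_eq_wordNorm {G : Type*} [Group G] (S : FiniteGeneratingSet G) (g : G) :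
    ∃ l : List G, IsWordFor S g l ∧ l.length = wordNorm S g := by
  have hg : g ∈ Subgroup.closure (S.carrier : Set G) := by
    rw [S.closure_eq_top]; exact Subgroup.mem_top g
  rw [← Subgroup.mem_toSubmonoid, Subgroup.closure_toSubmonoid] at hg
  obtain ⟨l, hl, hp⟩ := Submonoid.exists_list_of_mem_closure hg
  exact Nat.sInf_mem (s := {n : ℕ | ∃ l : List G, IsWordFor S g l ∧ l.length = n})
    ⟨l.length, l, ⟨by simpa using hl, hp⟩, rfl⟩

theorem wordNorm_le_length {G : Type*} [Group G] {S : FiniteGeneratingSet G} {g : G} {l : List G}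
    (hl : IsWordFor S g l) : wordNorm S g ≤ l.length :=
  Nat.sInf_le ⟨l, hl, rfl⟩

theorem wordNorm_one {G : Type*} [Group G] (S : FiniteGeneratingSet G) :
    wordNorm S (1 : G) = 0 :=
  Nat.le_zero.mp (wordNorm_le_length (l := []) ⟨by simp, by simp⟩)

theorem eq_one_of_wordNorm_eq_zero {G : Type*} [Group G] {S : FiniteGeneratingSet G} {g : G}
    (h : wordNorm S g = 0) : g = 1 := by
  obtain ⟨l, hl, hn⟩ := exists_word_length_eq_wordNorm S g
  rw [h, List.length_eq_zero_iff] at hn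
  rw [← hl.2, hn, List.prod_nil]

theorem wordNorm_mul_le {G : Type*} [Group G] (S : FiniteGeneratingSet G) (g h : G) :
    wordNorm S (g * h) ≤ wordNorm S g + wordNorm S h := by
  obtain ⟨l, hl, hn⟩ := exists_word_length_eq_wordNorm S g
  obtain ⟨m, hm, hk⟩ := exists_word_length_eq_wordNorm S h
  rw [← hn, ← hk, ← List.length_append]
  refine wordNorm_le_length ⟨fun a ha => ?_, by rw [List.prod_append, hl.2, hm.2]⟩
  rcases List.mem_append.mp ha with ha | ha
  · exact hl.1 a ha
  · exact hm.1 a ha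

theorem wordNorm_inv_le {G : Type*} [Group G] (S : FiniteGeneratingSet G) (g : G) :
    wordNorm S g⁻¹ ≤ wordNorm S g := by
  obtain ⟨l, hl, hn⟩ := exists_word_length_eq_wordNorm S g
  have hw : IsWordFor S g⁻¹ (l.map (fun x => x⁻¹)).reverse := by
    refine ⟨fun a ha => ?_, by rw [← hl.2, List.prod_inv_reverse]⟩
    obtain ⟨b, hb, rfl⟩ := List.mem_map.mp (List.mem_reverse.mp ha)
    rw [inv_inv]
    exact (hl.1 b hb).symm
  have := wordNorm_le_length hw
  rw [List.length_reverse, List.length_map] at this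
  omega

theorem wordNorm_inv {G : Type*} [Group G] (S : FiniteGeneratingSet G) (g : G) :
    wordNorm S g⁻¹ = wordNorm S g :=
  le_antisymm (wordNorm_inv_le S g) (by simpa using wordNorm_inv_le S g⁻¹)

/-- The group `G` as a set, to be equipped with the word metric of `S`. -/
@[nolint unusedArguments]
def WordMetricSpace {G : Type*} [Group G] (_S : FiniteGeneratingSet G) : Type _ := G

/-- The identity map from the group to the metric space `(G, d_S)`. -/
def toWordMetric {G : Type*} [Group G] (S : FiniteGeneratingSet G) (g : G) : WordMetricSpace S := g

/-- The identity map from the metric space `(G, d_S)` to the group. -/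
def ofWordMetric {G : Type*} [Group G] (S : FiniteGeneratingSet G) (g : WordMetricSpace S) : G := g

/-- The word metric `d_S(g, h) = |g⁻¹ h|_S`. -/
noncomputable instance wordMetric {G : Type*} [Group G] (S : FiniteGeneratingSet G) :
    MetricSpace (WordMetricSpace S) where
  dist g h := (wordNorm S ((ofWordMetric S g)⁻¹ * ofWordMetric S h) : ℝ)
  dist_self g := by rw [inv_mul_cancel, wordNorm_one, Nat.cast_zero]
  dist_comm g h := by
    rw [← wordNorm_inv S ((ofWordMetric S g)⁻¹ * ofWordMetric S h), mul_inv_rev, inv_inv]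
  dist_triangle g h k := by
    have := wordNorm_mul_le S ((ofWordMetric S g)⁻¹ * ofWordMetric S h)
      ((ofWordMetric S h)⁻¹ * ofWordMetric S k)
    rw [mul_assoc, mul_inv_cancel_left] at this
    exact_mod_cast this
  eq_of_dist_eq_zero {g h} hgh := by
    have h0 := eq_one_of_wordNorm_eq_zero (Nat.cast_eq_zero.mp hgh)
    exact (inv_mul_eq_one (G := G)).mp h0

/-! ### Proper actions and stable subgroups -/

/-- An action on a metric space is (metrically) proper if for every compact `K` only finitely many
group elements `g` satisfy `gK ∩ K ≠ ∅`. -/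
def IsProperAction (G X : Type*) [Group G] [MetricSpace X] [MulAction G X] : Prop :=
  ∀ K : Set X, IsCompact K → {g : G | ((fun y => g • y) '' K ∩ K).Nonempty}.Finite

/-- The orbit map `h ↦ h x`, restricted to the subgroup `H` with the word metric of `T`. -/
def orbitMapOn {G X : Type*} [Group G] [MulAction G X] (H : Subgroup G)
    (T : FiniteGeneratingSet H) (x : X) : WordMetricSpace T → X :=
  fun h => ((ofWordMetric T h : H) : G) • x

/-- The inclusion `H → G` as a map of metric spaces `(H, d_T) → (G, d_S)`. -/
def inclusionOn {G : Type*} [Group G] (H : Subgroup G) (T : FiniteGeneratingSet H)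
    (S : FiniteGeneratingSet G) : WordMetricSpace T → WordMetricSpace S :=
  fun h => toWordMetric S ((ofWordMetric T h : H) : G)

/-- `H` is a stable subgroup of `G`: it is finitely generated and, for all choices of word metrics
on `H` and `G`, it is undistorted in `G` (the inclusion is a quasi-isometric embedding) and it is a
stable subset of `G`. -/
def IsStableSubgroup {G : Type*} [Group G] (H : Subgroup G) : Prop :=
  H.FG ∧ ∀ (S : FiniteGeneratingSet G) (T : FiniteGeneratingSet H),
    IsQIEmbedding (inclusionOn H T S) ∧
      IsStableSubset (toWordMetric S '' (H : Set G))

/-!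
The orbit map `f : G → X`, `g ↦ g • x`, is Lipschitz and, by properness, points with nearby images
are close, but `f` need not be a quasi-isometric embedding. Hence a quasigeodesic of `G` with
endpoints in `H` only becomes a path in `X` of controlled length. The point is that it stays at
bounded distance from `H` (`exists_dist_le_of_isDiscreteQuasigeodesic`). Once this is known, its
projection to `H` is mapped to a quasigeodesic in `X`, stability in `X` applies, and the conclusion
pulls back to `G` (`isStableSubset_range_of_comp`).

For the bound, let `Y = H • x`. Fix a large `M`, let `D` be a Morse constant of `Y` for
`M`-quasigeodesics (`IsStableEmbedding.exists_mem_thickening`), and measure chains in `X` with steps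
of length at most `1` with weight `M` in the `D`-neighborhood of `Y` and weight `1` elsewhere.
A cheapest chain is an `M`-quasigeodesic (`IsGeodesicMetricSpace.exists_minimal_chain`), so if its
endpoints are in `Y` it stays where the weight is `M`, and its cost is at least `M * d` where `d` is
the distance of its endpoints. On the other hand, an excursion of a quasigeodesic of `G` away from a
large neighborhood of `H` maps to a path in `X` avoiding the `D`-neighborhood of `Y`. Its length, and
so its cost, is at most `c * d` plus a constant, where `c` does not depend on `M`, because `H` is
quasi-isometrically embedded in `X`. When `M` exceeds `c` this bounds `d`, hence the length of the
excursion.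
-/

/-! ### Quasigeodesics indexed by integers -/

/-- `z 0, …, z n` is a `K`-quasigeodesic indexed by integers. The lower bound is stated without
division, which makes the predicate monotone in `K`. -/
def IsDiscreteQuasigeodesic {X : Type*} [MetricSpace X] (K : ℝ) (n : ℕ) (z : ℕ → X) : Prop :=
  ∀ i j : ℕ, i ≤ j → j ≤ n →
    dist (z i) (z j) ≤ K * ((j : ℝ) - i) + K ∧ (j : ℝ) - i ≤ K * dist (z i) (z j) + K

theorem IsDiscreteQuasigeodesic.mono {X : Type*} [MetricSpace X] {K K' : ℝ} {n : ℕ} {z : ℕ → X}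
    (h : IsDiscreteQuasigeodesic K n z) (hK : K ≤ K') : IsDiscreteQuasigeodesic K' n z := by
  intro i j hij hj
  obtain ⟨h1, h2⟩ := h i j hij hj
  have h3 : (0 : ℝ) ≤ (j : ℝ) - i := sub_nonneg.mpr (by exact_mod_cast hij)
  have h4 := mul_le_mul_of_nonneg_right hK h3
  have h5 := mul_le_mul_of_nonneg_right hK (dist_nonneg (x := z i) (y := z j))
  exact ⟨by linarith, by linarith⟩

theorem isQIEmbeddingWith_of_le {Y X : Type*} [MetricSpace Y] [MetricSpace X] {K : ℝ} {φ : Y → X}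
    (hK : 1 ≤ K) (h : ∀ a b, dist (φ a) (φ b) ≤ K * dist a b + K ∧
      dist a b ≤ K * dist (φ a) (φ b) + K * K) : IsQIEmbeddingWith K K φ := by
  intro a b
  have hK0 : 0 < K := by linarith
  refine ⟨?_, (h a b).1⟩
  have h2 : (1 / K) * dist a b ≤ (1 / K) * (K * (dist (φ a) (φ b) + K)) :=
    mul_le_mul_of_nonneg_left (by linarith [(h a b).2]) (by positivity)
  rw [← mul_assoc, one_div_mul_cancel hK0.ne', one_mul] at h2
  linarith

theorem IsQIEmbeddingWith.dist_le {Y X : Type*} [MetricSpace Y] [MetricSpace X] {κ lam : ℝ}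
    {φ : Y → X} (h : IsQIEmbeddingWith κ lam φ) (hκ : 1 ≤ κ) (a b : Y) :
    dist a b ≤ κ * (dist (φ a) (φ b) + lam) := by
  have hκ0 : 0 < κ := by linarith
  have h1 : (1 / κ) * dist a b ≤ dist (φ a) (φ b) + lam := by linarith [(h a b).1]
  have h2 := mul_le_mul_of_nonneg_left h1 hκ0.le
  rwa [← mul_assoc, mul_one_div_cancel hκ0.ne', one_mul] at h2

/-- Extending a discrete quasigeodesic by the floor function gives a quasigeodesic on a real
interval. -/
theorem IsDiscreteQuasigeodesic.floor {X : Type*} [MetricSpace X] {K : ℝ} {n : ℕ} {z : ℕ → X}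
    (h : IsDiscreteQuasigeodesic K n z) (hK : 1 ≤ K) :
    IsQuasigeodesicBetween (2 * K) 0 n (fun u => z ⌊u⌋₊) (z 0) (z n) := by
  refine ⟨Nat.cast_nonneg n, by simp, by simp, isQIEmbeddingWith_of_le (by linarith) ?_⟩
  have key : ∀ u v : Set.Icc (0 : ℝ) n, (u : ℝ) ≤ v →
      dist (z ⌊(u : ℝ)⌋₊) (z ⌊(v : ℝ)⌋₊) ≤ 2 * K * dist u v + 2 * K ∧
      dist u v ≤ 2 * K * dist (z ⌊(u : ℝ)⌋₊) (z ⌊(v : ℝ)⌋₊) + 2 * K * (2 * K) := by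
    intro u v huv
    have hd : dist u v = (v : ℝ) - u := by
      rw [dist_comm, Subtype.dist_eq, Real.dist_eq, abs_of_nonneg (by linarith)]
    obtain ⟨h1, h2⟩ := h ⌊(u : ℝ)⌋₊ ⌊(v : ℝ)⌋₊ (Nat.floor_le_floor huv)
      (Nat.floor_le_of_le v.2.2)
    rw [hd]
    have hu1 := Nat.floor_le u.2.1
    have hu2 := Nat.lt_floor_add_one (u : ℝ)
    have hv1 := Nat.floor_le v.2.1
    have hv2 := Nat.lt_floor_add_one (v : ℝ)
    have h3 : K * ((⌊(v : ℝ)⌋₊ : ℝ) - ⌊(u : ℝ)⌋₊) ≤ K * ((v : ℝ) - u + 1) :=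
      mul_le_mul_of_nonneg_left (by linarith) (by linarith)
    have h4 : 0 ≤ K * ((v : ℝ) - u) := mul_nonneg (by linarith) (by linarith)
    have h5 : 0 ≤ K * dist (z ⌊(u : ℝ)⌋₊) (z ⌊(v : ℝ)⌋₊) := mul_nonneg (by linarith) dist_nonneg
    exact ⟨by linarith, by nlinarith⟩
  intro u v
  rcases le_total (u : ℝ) v with huv | huv
  · exact key u v huv
  · simpa only [dist_comm] using key v u huv

/-- Sampling a quasigeodesic at integer distances from its starting time. The last sample, which
is the endpoint, may come early, whence the loss in the constant. -/
theorem IsQuasigeodesicBetween.isDiscreteQuasigeodesic {X : Type*} [MetricSpace X]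
    {κ s t : ℝ} {q : ℝ → X} {a b : X} (h : IsQuasigeodesicBetween κ s t q a b) (hκ : 1 ≤ κ) :
    IsDiscreteQuasigeodesic (κ * κ + 1) ⌈t - s⌉₊ (fun i => q (min (s + i) t)) := by
  obtain ⟨hst, -, -, hq⟩ := h
  intro i j hij hj
  have hmem : ∀ k : ℕ, min (s + k) t ∈ Set.Icc s t := fun k =>
    ⟨le_min (by linarith [Nat.cast_nonneg (α := ℝ) k]) hst, min_le_right _ _⟩
  have hij' : (i : ℝ) ≤ j := by exact_mod_cast hij
  have hj' : (j : ℝ) < t - s + 1 :=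
    lt_of_le_of_lt (by exact_mod_cast hj) (Nat.ceil_lt_add_one (by linarith))
  have hd : dist (⟨_, hmem i⟩ : Set.Icc s t) ⟨_, hmem j⟩ = min (s + j) t - min (s + i) t := by
    rw [dist_comm, Subtype.dist_eq, Real.dist_eq,
      abs_of_nonneg (sub_nonneg.mpr (min_le_min_right _ (by linarith)))]
  have h1 := (hq ⟨_, hmem i⟩ ⟨_, hmem j⟩).2
  have h2 := hq.dist_le hκ ⟨_, hmem i⟩ ⟨_, hmem j⟩
  rw [hd] at h1 h2
  simp only at h1 h2 ⊢
  have h3 : min (s + j) t - min (s + i) t ≤ (j : ℝ) - i := by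
    rcases min_cases (s + (j : ℝ)) t with h | h <;> rcases min_cases (s + (i : ℝ)) t with h' | h' <;>
      linarith
  have h4 : (j : ℝ) - i - 1 ≤ min (s + j) t - min (s + i) t := by
    rcases min_cases (s + (j : ℝ)) t with h | h <;> rcases min_cases (s + (i : ℝ)) t with h' | h' <;>
      linarith
  have h5 : κ ≤ κ * κ + 1 := by nlinarith
  have h6 : κ * (min (s + j) t - min (s + i) t) ≤ κ * ((j : ℝ) - i) :=
    mul_le_mul_of_nonneg_left h3 (by linarith)
  have h7 : κ * ((j : ℝ) - i) ≤ (κ * κ + 1) * ((j : ℝ) - i) :=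
    mul_le_mul_of_nonneg_right h5 (by linarith)
  have h8 := mul_le_mul_of_nonneg_right h5
    (dist_nonneg (x := q (min (s + i) t)) (y := q (min (s + j) t)))
  exact ⟨by linarith, by linarith⟩

/-! ### Weighted chains -/

/-- `WeightedChain w a b k`: there is a chain from `a` to `b` with steps of length at most `1`
whose cost, the sum of the weights `w` of the starting points of its steps, is `k`. -/
inductive WeightedChain {X : Type*} [MetricSpace X] (w : X → ℕ) : X → X → ℕ → Prop
  | refl (a : X) : WeightedChain w a a 0
  | step {a b c : X} {k : ℕ} : dist a b ≤ 1 → WeightedChain w b c k → WeightedChain w a c (w a + k)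

/-- The least cost of a chain with steps of length at most `1`. -/
noncomputable def chainCost {X : Type*} [MetricSpace X] (w : X → ℕ) (a b : X) : ℕ :=
  sInf {k | WeightedChain w a b k}

theorem WeightedChain.trans {X : Type*} [MetricSpace X] {w : X → ℕ} {a b c : X} {k l : ℕ}
    (h : WeightedChain w a b k) (h' : WeightedChain w b c l) : WeightedChain w a c (k + l) := by
  induction h with
  | refl a => simpa using h'
  | step hd _ ih => rw [add_assoc]; exact .step hd (ih h')

theorem weightedChain_of_seq {X : Type*} [MetricSpace X] (w : X → ℕ) (z : ℕ → X) (n : ℕ)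
    (h : ∀ i < n, dist (z i) (z (i + 1)) ≤ 1) :
    WeightedChain w (z 0) (z n) (∑ i ∈ Finset.range n, w (z i)) := by
  induction n with
  | zero => simpa using WeightedChain.refl (z 0)
  | succ n ih =>
    rw [Finset.sum_range_succ]
    exact (ih fun i hi => h i (by omega)).trans (.step (h n (by omega)) (.refl _))

theorem WeightedChain.exists_seq {X : Type*} [MetricSpace X] {w : X → ℕ} {a b : X} {k : ℕ}
    (h : WeightedChain w a b k) : ∃ (n : ℕ) (z : ℕ → X), z 0 = a ∧ z n = b ∧
      (∀ i < n, dist (z i) (z (i + 1)) ≤ 1) ∧ ∑ i ∈ Finset.range n, w (z i) = k := by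
  induction h with
  | refl a => exact ⟨0, fun _ => a, rfl, rfl, by simp, by simp⟩
  | @step a b c k hd _ ih =>
    obtain ⟨n, z, h0, hn, hz, hs⟩ := ih
    refine ⟨n + 1, fun i => Nat.casesOn i a z, rfl, hn, ?_, ?_⟩
    · rintro (_ | i) hi
      · simpa [h0] using hd
      · exact hz i (by omega)
    · rw [Finset.sum_range_succ']
      exact (congrArg (· + w a) hs).trans (add_comm _ _)

theorem WeightedChain.chainCost_le {X : Type*} [MetricSpace X] {w : X → ℕ} {a b : X} {k : ℕ}
    (h : WeightedChain w a b k) : chainCost w a b ≤ k :=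
  Nat.sInf_le h

/-- Subdividing a geodesic into steps of length at most `1`. -/
theorem IsGeodesicMetricSpace.exists_weightedChain {X : Type*} [MetricSpace X]
    (hX : IsGeodesicMetricSpace X) (w : X → ℕ) {B : ℕ} (a b : X)
    (hB : ∀ z, dist a z ≤ dist a b → w z ≤ B) :
    ∃ k ≤ B * ⌈dist a b⌉₊, WeightedChain w a b k := by
  obtain ⟨γ, h0, h1, hγ⟩ := hX a b
  have hmem : ∀ i : ℕ, min (i : ℝ) (dist a b) ∈ Set.Icc 0 (dist a b) := fun i =>
    ⟨le_min (Nat.cast_nonneg i) dist_nonneg, min_le_right _ _⟩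
  have h := weightedChain_of_seq w (fun i : ℕ => γ (min i (dist a b))) ⌈dist a b⌉₊ ?_
  · refine ⟨_, ?_, by simpa [h0, h1, Nat.le_ceil] using h⟩
    calc ∑ i ∈ Finset.range ⌈dist a b⌉₊, w (γ (min i (dist a b)))
        ≤ ∑ i ∈ Finset.range ⌈dist a b⌉₊, B := by
          refine Finset.sum_le_sum fun i _ => hB _ ?_
          have := hγ 0 ⟨le_rfl, dist_nonneg⟩ _ (hmem i)
          rw [h0] at this
          rw [this, zero_sub, abs_neg, abs_of_nonneg (hmem i).1]
          exact min_le_right _ _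
      _ = B * ⌈dist a b⌉₊ := by simp [mul_comm]
  · intro i _
    rw [hγ _ (hmem i) _ (hmem (i + 1))]
    push_cast
    rw [abs_le]
    constructor <;>
    rcases min_cases (i : ℝ) (dist a b) with h | h <;>
    rcases min_cases ((i : ℝ) + 1) (dist a b) with h' | h' <;> linarith

theorem IsGeodesicMetricSpace.chainCost_le {X : Type*} [MetricSpace X]
    (hX : IsGeodesicMetricSpace X) (w : X → ℕ) {B : ℕ} (a b : X)
    (hB : ∀ z, dist a z ≤ dist a b → w z ≤ B) : chainCost w a b ≤ B * ⌈dist a b⌉₊ := by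
  obtain ⟨k, hk, h⟩ := hX.exists_weightedChain w a b hB
  exact h.chainCost_le.trans hk

theorem IsGeodesicMetricSpace.weightedChain_chainCost {X : Type*} [MetricSpace X]
    (hX : IsGeodesicMetricSpace X) {w : X → ℕ} {M : ℕ} (hw : ∀ z, w z ≤ M) (a b : X) :
    WeightedChain w a b (chainCost w a b) := by
  obtain ⟨k, -, h⟩ := hX.exists_weightedChain w a b fun z _ => hw z
  exact Nat.sInf_mem (s := {k | WeightedChain w a b k}) ⟨k, h⟩

theorem IsGeodesicMetricSpace.chainCost_triangle {X : Type*} [MetricSpace X]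
    (hX : IsGeodesicMetricSpace X) {w : X → ℕ} {M : ℕ} (hw : ∀ z, w z ≤ M) (a b c : X) :
    chainCost w a c ≤ chainCost w a b + chainCost w b c :=
  ((hX.weightedChain_chainCost hw a b).trans (hX.weightedChain_chainCost hw b c)).chainCost_le

/-- For a weight with values between `1` and `M`, a chain of least cost is an `M`-quasigeodesic: each
part of it has least cost, and its number of steps is at most its cost, which is at most `M` times
the number of steps along a geodesic. -/
theorem IsGeodesicMetricSpace.exists_minimal_chain {X : Type*} [MetricSpace X]
    (hX : IsGeodesicMetricSpace X) {w : X → ℕ} {M : ℕ} (hw1 : ∀ z, 1 ≤ w z) (hw : ∀ z, w z ≤ M)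
    (a b : X) : ∃ (n : ℕ) (z : ℕ → X), z 0 = a ∧ z n = b ∧ dist a b ≤ n ∧
      IsDiscreteQuasigeodesic M n z ∧ ∑ i ∈ Finset.range n, w (z i) = chainCost w a b := by
  obtain ⟨n, z, h0, hn, hz, hs⟩ := (hX.weightedChain_chainCost hw a b).exists_seq
  have hM : (1 : ℝ) ≤ M := by exact_mod_cast (hw1 a).trans (hw a)
  have hdist : ∀ i k, i + k ≤ n → dist (z i) (z (i + k)) ≤ k := by
    intro i k
    induction k with
    | zero => simp
    | succ k ih =>
      intro hk
      have h1 := dist_triangle (z i) (z (i + k)) (z (i + (k + 1)))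
      have h2 := hz (i + k) (by omega)
      have h3 := ih (by omega)
      rw [← add_assoc] at h1 ⊢
      push_cast
      linarith
  have hcost : ∀ i k, i + k ≤ n →
      chainCost w (z i) (z (i + k)) ≤ ∑ m ∈ Finset.range k, w (z (i + m)) := fun i k hk =>
    (weightedChain_of_seq w (fun m => z (i + m)) k fun m hm => hz (i + m) (by omega)).chainCost_le
  refine ⟨n, z, h0, hn, by simpa [h0, hn] using hdist 0 n (by omega), ?_, hs⟩
  intro i j hij hj
  obtain ⟨k, rfl⟩ := Nat.exists_eq_add_of_le hij
  obtain ⟨l, rfl⟩ := Nat.exists_eq_add_of_le hj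
  have hd := hdist i k hj
  have hk0 : (0 : ℝ) ≤ k := Nat.cast_nonneg k
  push_cast
  rw [add_sub_cancel_left]
  refine ⟨by nlinarith, ?_⟩
  have h1 : k ≤ ∑ m ∈ Finset.range k, w (z (i + m)) := by
    simpa using Finset.sum_le_sum (s := Finset.range k) fun m _ => hw1 (z (i + m))
  have h2 : chainCost w a b ≤ chainCost w a (z i) + chainCost w (z i) (z (i + k)) +
      chainCost w (z (i + k)) b :=
    (hX.chainCost_triangle hw a (z (i + k)) b).trans
      (Nat.add_le_add_right (hX.chainCost_triangle hw a (z i) (z (i + k))) _)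
  have h3 := hcost 0 i (by omega)
  have h4 := hcost (i + k) l le_rfl
  rw [← hs, Finset.sum_range_add, Finset.sum_range_add] at h2
  simp only [zero_add, h0, hn] at h3 h4
  have h5 : k ≤ M * ⌈dist (z i) (z (i + k))⌉₊ := by
    have := hX.chainCost_le w (z i) (z (i + k)) fun z _ => hw z
    omega
  have h6 := Nat.ceil_lt_add_one (dist_nonneg (x := z i) (y := z (i + k)))
  have h7 : (k : ℝ) ≤ M * (⌈dist (z i) (z (i + k))⌉₊ : ℝ) := by exact_mod_cast h5
  nlinarith

/-! ### Pulling back stability -/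

/-- Any two points are joined by a finite sequence on which the distance is the difference of the
indices, as in the vertex set of a connected graph. -/
def IsDiscretelyGeodesic (Y : Type*) [MetricSpace Y] : Prop :=
  ∀ a b : Y, ∃ (n : ℕ) (y : ℕ → Y), y 0 = a ∧ y n = b ∧
    ∀ i j : ℕ, i ≤ j → j ≤ n → dist (y i) (y j) = (j : ℝ) - i

/-- The Morse property of the image of a stable embedding. The second quasigeodesic needed to apply
stability is the image of a geodesic of the source, which lies in the range. -/
theorem IsStableEmbedding.exists_mem_thickening {Y X : Type*} [MetricSpace Y] [MetricSpace X]
    {φ : Y → X} (hφ : IsStableEmbedding φ) (hY : IsDiscretelyGeodesic Y) {K : ℝ} (hK : 1 ≤ K) :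
    ∃ D : ℝ, 0 < D ∧ ∀ (n : ℕ) (z : ℕ → X) (a b : Y), z 0 = φ a → z n = φ b →
      IsDiscreteQuasigeodesic K n z → ∀ i ≤ n, z i ∈ Metric.thickening D (Set.range φ) := by
  obtain ⟨⟨κ, lam, hκ, hlam, hqi⟩, hst⟩ := hφ
  have hκl : 0 < κ * lam := by positivity
  obtain ⟨D, hD, h⟩ := hst (2 * (K + κ + lam + κ * lam)) (by linarith)
  refine ⟨D, hD, fun n z a b ha hb hz i hi => ?_⟩
  obtain ⟨m, y, h0, hm, hy⟩ := hY a b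
  have hφy : IsDiscreteQuasigeodesic (κ + lam + κ * lam) m (φ ∘ y) := by
    intro i j hij hj
    have h1 := (hqi (y i) (y j)).2
    have h2 := hqi.dist_le hκ (y i) (y j)
    rw [hy i j hij hj] at h1 h2
    have h3 : (0 : ℝ) ≤ (j : ℝ) - i := sub_nonneg.mpr (by exact_mod_cast hij)
    have h4 : 0 ≤ (lam + κ * lam) * ((j : ℝ) - i) := by positivity
    have h5 : 0 ≤ (lam + κ * lam) * dist (φ (y i)) (φ (y j)) := by positivity
    simp only [Function.comp]
    exact ⟨by linarith, by linarith⟩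
  have hq := (hz.mono (K' := K + κ + lam + κ * lam) (by linarith)).floor (by linarith)
  have hq' := (hφy.mono (K' := K + κ + lam + κ * lam) (by linarith)).floor (by linarith)
  simp only [Function.comp, h0, hm, ha, hb] at hq hq'
  have h1 := (h _ ⟨a, rfl⟩ _ ⟨b, rfl⟩ _ _ _ _ _ _ hq hq').1
  have h2 : z i ∈ (fun u : ℝ => z ⌊u⌋₊) '' Set.Icc (0 : ℝ) n :=
    ⟨i, ⟨Nat.cast_nonneg i, by exact_mod_cast hi⟩, by simp⟩
  refine Metric.thickening_subset_of_subset D ?_ (h1 h2)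
  rintro _ ⟨u, -, rfl⟩
  exact ⟨_, rfl⟩

/-- The last index before `i`, and the first one after `i`, at which a predicate holds. -/
theorem exists_last_before_first_after {p : ℕ → Prop} {i N : ℕ} (h0 : p 0) (hN : p N)
    (hiN : i ≤ N) (hi : ¬ p i) : ∃ j k : ℕ, j < i ∧ i < k ∧ k ≤ N ∧ p j ∧ p k ∧
      ∀ m, j < m → m < k → ¬ p m := by
  classical
  have hex : ∃ k, i ≤ k ∧ p k := ⟨N, hiN, hN⟩
  have hj := Nat.findGreatest_spec (P := p) (Nat.zero_le i) h0
  have hk := Nat.find_spec hex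
  refine ⟨Nat.findGreatest p i, Nat.find hex, ?_, ?_, Nat.find_min' hex ⟨hiN, hN⟩, hj, hk.2, ?_⟩
  · exact lt_of_le_of_ne (Nat.findGreatest_le i) fun h => hi (h ▸ hj)
  · exact lt_of_le_of_ne hk.1 fun h => hi (h ▸ hk.2)
  · intro m hm1 hm2
    rcases le_total m i with hm | hm
    · exact Nat.findGreatest_is_greatest hm1 hm
    · exact fun hp => Nat.find_min hex hm2 ⟨hm, hp⟩

theorem chainCost_le_of_steps {X : Type*} [MetricSpace X] (hX : IsGeodesicMetricSpace X)
    {w : X → ℕ} {M C : ℕ} (hw : ∀ z, w z ≤ M) (x : ℕ → X) {j : ℕ} (k : ℕ)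
    (h : ∀ i, j ≤ i → i < j + k → chainCost w (x i) (x (i + 1)) ≤ C) :
    chainCost w (x j) (x (j + k)) ≤ k * C := by
  induction k with
  | zero => simpa using (WeightedChain.refl (w := w) (x j)).chainCost_le
  | succ k ih =>
    have h1 := ih fun i hi hik => h i hi (by omega)
    have h2 := h (j + k) (by omega) (by omega)
    have h3 := hX.chainCost_triangle hw (x j) (x (j + k)) (x (j + k + 1))
    rw [← add_assoc, add_mul, one_mul]
    omega

/-- A quasigeodesic of `P` with endpoints in `range ι` stays close to `range ι`. -/
theorem exists_dist_le_of_isDiscreteQuasigeodesic {Y P X : Type*} [MetricSpace Y] [MetricSpace P]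
    [MetricSpace X] (hX : IsGeodesicMetricSpace X) (hY : IsDiscretelyGeodesic Y)
    {ι : Y → P} {f : P → X} {A L : NNReal} (hι : LipschitzWith A ι) (hf : LipschitzWith L f)
    (hproper : ∀ C : ℝ, ∃ F : ℝ, ∀ p q : P, dist (f p) (f q) ≤ C → dist p q ≤ F)
    (hφ : IsStableEmbedding (f ∘ ι)) {K : ℝ} (hK : 1 ≤ K) :
    ∃ R : ℝ, ∀ (N : ℕ) (c : ℕ → P), c 0 ∈ Set.range ι → c N ∈ Set.range ι →
      IsDiscreteQuasigeodesic K N c → ∀ i ≤ N, ∃ y, dist (c i) (ι y) ≤ R := by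
  obtain ⟨κ, lam, hκ, hlam, hqi⟩ := hφ.1
  -- `C` bounds the steps of the image in `X` of a quasigeodesic, and `n ≤ α * d + β` will bound the
  -- length `n` of an excursion by the distance `d` between its ends. The weight `M` near the range
  -- of `f ∘ ι` has to exceed the slope `C * α` of the resulting bound on the cost.
  set C : ℕ := ⌈(L : ℝ) * (2 * K)⌉₊ with hC
  have hCl : (L : ℝ) * (2 * K) ≤ C := Nat.le_ceil _
  set α : ℝ := K * (A * κ) with hα
  have hα0 : 0 ≤ α := by positivity
  obtain ⟨M, hM⟩ := exists_nat_ge (C * α + 1)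
  have hC0 : (0 : ℝ) ≤ C := Nat.cast_nonneg C
  have hM1 : (1 : ℝ) ≤ M := by nlinarith [mul_nonneg hC0 hα0]
  obtain ⟨D, hD, hmorse⟩ := hφ.exists_mem_thickening hY hM1
  obtain ⟨F, hF⟩ := hproper (D + C)
  set R : ℝ := max F 0 with hR
  have hR0 : 0 ≤ R := le_max_right _ _
  set β : ℝ := K * (A * (κ * lam) + 2 * R) + K with hβ
  set E : ℕ := ⌈(L : ℝ) * (R + 2 * K)⌉₊ with hE
  set d₀ : ℝ := 2 * (M * E) + C * β with hd₀
  have hβ0 : 0 ≤ β := by positivity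
  have hd₀0 : 0 ≤ d₀ := by positivity
  refine ⟨R + (K * (α * d₀ + β) + K), fun N c hc0 hcN hc i hi => ?_⟩
  by_cases hclose : ∃ y, dist (c i) (ι y) ≤ R
  · obtain ⟨y, hy⟩ := hclose
    exact ⟨y, by linarith [show 0 ≤ K * (α * d₀ + β) + K by positivity]⟩
  have hself : ∀ p ∈ Set.range ι, ∃ y, dist p (ι y) ≤ R := by
    rintro _ ⟨y, rfl⟩
    exact ⟨y, by simpa using hR0⟩
  obtain ⟨j, k, hji, hik, hkN, ⟨y₁, hy₁⟩, ⟨y₂, hy₂⟩, hfar⟩ :=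
    exists_last_before_first_after (p := fun i => ∃ y, dist (c i) (ι y) ≤ R)
      (hself _ hc0) (hself _ hcN) hi hclose
  have hjk : (0 : ℝ) ≤ (k : ℝ) - j := sub_nonneg.mpr (by exact_mod_cast (hji.trans hik).le)
  have hstep : ∀ m < N, dist (c m) (c (m + 1)) ≤ 2 * K := fun m hm => by
    have := (hc m (m + 1) (by omega) (by omega)).1
    push_cast at this
    linarith
  set d : ℝ := dist (f (ι y₁)) (f (ι y₂)) with hd
  have hlen : (k : ℝ) - j ≤ α * d + β := by
    have h1 := (hc j k (by omega) hkN).2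
    have h2 : dist (c j) (c k) ≤ dist (ι y₁) (ι y₂) + 2 * R := by
      have := dist_triangle4 (c j) (ι y₁) (ι y₂) (c k)
      rw [dist_comm (ι y₂)] at this
      linarith
    have h3 := hι.dist_le_mul y₁ y₂
    have h4 : dist y₁ y₂ ≤ κ * (d + lam) := hqi.dist_le hκ y₁ y₂
    have h5 := mul_le_mul_of_nonneg_left h4 A.coe_nonneg
    have h6 : dist (c j) (c k) ≤ A * (κ * (d + lam)) + 2 * R := by linarith
    have h7 := mul_le_mul_of_nonneg_left h6 (by linarith : (0 : ℝ) ≤ K)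
    rw [hα, hβ]
    linarith
  classical
  set w : X → ℕ := fun z => if z ∈ Metric.thickening D (Set.range (f ∘ ι)) then M else 1 with hw
  have hM1' : 1 ≤ M := by exact_mod_cast hM1
  have hw1 : ∀ z, 1 ≤ w z := fun z => by
    simp only [hw]
    split_ifs <;> omega
  have hwM : ∀ z, w z ≤ M := fun z => by
    simp only [hw]
    split_ifs <;> omega
  have hcost : M * d ≤ chainCost w (f (ι y₁)) (f (ι y₂)) := by
    obtain ⟨n, z, hz0, hzn, hdn, hz, hs⟩ := hX.exists_minimal_chain hw1 hwM (f (ι y₁)) (f (ι y₂))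
    have h1 : ∑ i ∈ Finset.range n, w (z i) = n * M := by
      rw [Finset.sum_congr rfl fun i hi => if_pos
        (hmorse n z y₁ y₂ hz0 hzn hz i (Finset.mem_range.mp hi).le)]
      simp
    rw [← hs, h1]
    push_cast
    nlinarith
  have hend : ∀ p q : X, dist p q ≤ L * (R + 2 * K) → chainCost w p q ≤ M * E := fun p q hpq =>
    (hX.chainCost_le w p q fun z _ => hwM z).trans
      (Nat.mul_le_mul_left _ (Nat.ceil_le_ceil hpq))
  have h1 : chainCost w (f (ι y₁)) (f (c (j + 1))) ≤ M * E := by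
    refine hend _ _ ((hf.dist_le_mul _ _).trans (mul_le_mul_of_nonneg_left ?_ L.coe_nonneg))
    have := dist_triangle (ι y₁) (c j) (c (j + 1))
    rw [dist_comm (ι y₁) (c j)] at this
    linarith [hstep j (by omega)]
  have h2 : chainCost w (f (c (k - 1))) (f (ι y₂)) ≤ M * E := by
    refine hend _ _ ((hf.dist_le_mul _ _).trans (mul_le_mul_of_nonneg_left ?_ L.coe_nonneg))
    have h := hstep (k - 1) (by omega)
    rw [Nat.sub_add_cancel (by omega)] at h
    linarith [dist_triangle (c (k - 1)) (c k) (ι y₂)]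
  have h3 : chainCost w (f (c (j + 1))) (f (c (j + 1 + (k - 1 - (j + 1))))) ≤
      (k - 1 - (j + 1)) * C := by
    refine chainCost_le_of_steps hX hwM (f ∘ c) _ fun m hm1 hm2 => ?_
    have hfm : dist (f (c m)) (f (c (m + 1))) ≤ C :=
      ((hf.dist_le_mul _ _).trans
        (mul_le_mul_of_nonneg_left (hstep m (by omega)) L.coe_nonneg)).trans hCl
    refine (hX.chainCost_le w (B := 1) _ _ fun z hz => ?_).trans
      (by simpa using hfm)
    -- `c m` is far from `range ι`, hence `f (c m)` is at distance more than `D + C` from the range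
    -- of `f ∘ ι`, and the geodesic to `f (c (m + 1))` does not enter the region of weight `M`.
    refine le_of_eq (if_neg fun hmem => hfar m (by omega) (by omega) ?_)
    obtain ⟨_, ⟨y, rfl⟩, hy⟩ := Metric.mem_thickening_iff.mp hmem
    refine ⟨y, (hF _ _ ?_).trans (le_max_left _ _)⟩
    have := dist_triangle (f (c m)) z (f (ι y))
    simp only [Function.comp] at hz hy
    linarith
  rw [show j + 1 + (k - 1 - (j + 1)) = k - 1 by omega] at h3
  have h4 : chainCost w (f (ι y₁)) (f (ι y₂)) ≤ 2 * (M * E) + (k - j) * C := by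
    have h5 := hX.chainCost_triangle hwM (f (ι y₁)) (f (c (k - 1))) (f (ι y₂))
    have h6 := hX.chainCost_triangle hwM (f (ι y₁)) (f (c (j + 1))) (f (c (k - 1)))
    have h7 : (k - 1 - (j + 1)) * C ≤ (k - j) * C := Nat.mul_le_mul_right _ (by omega)
    omega
  have h5 : (chainCost w (f (ι y₁)) (f (ι y₂)) : ℝ) ≤ 2 * (M * E) + ((k : ℝ) - j) * C := by
    rw [← Nat.cast_sub (by omega : j ≤ k)]
    exact_mod_cast h4
  have hdd : d ≤ d₀ := by
    have h6 := mul_le_mul_of_nonneg_right hlen hC0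
    have h7 := mul_le_mul_of_nonneg_right hM (dist_nonneg : 0 ≤ d)
    rw [hd₀]
    linarith
  refine ⟨y₁, ?_⟩
  have h6 := (hc j i hji.le hi).1
  have h7 : (i : ℝ) - j ≤ α * d₀ + β := by
    have : (i : ℝ) ≤ k := by exact_mod_cast hik.le
    linarith [mul_le_mul_of_nonneg_left hdd hα0]
  have h8 := mul_le_mul_of_nonneg_left h7 (by linarith : (0 : ℝ) ≤ K)
  have h9 := dist_triangle (c i) (c j) (ι y₁)
  rw [dist_comm (c i) (c j)] at h9
  linarith

/-- The version for quasigeodesics on real intervals. Points of `range ι` are their own projections,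
so that endpoints are preserved by the projection to `range ι`. -/
theorem exists_projection_of_isQuasigeodesicBetween {Y P X : Type*} [MetricSpace Y] [MetricSpace P]
    [MetricSpace X] (hX : IsGeodesicMetricSpace X) (hY : IsDiscretelyGeodesic Y)
    {ι : Y → P} {f : P → X} {A L : NNReal} (hι : LipschitzWith A ι) (hf : LipschitzWith L f)
    (hproper : ∀ C : ℝ, ∃ F : ℝ, ∀ p q : P, dist (f p) (f q) ≤ C → dist p q ≤ F)
    (hφ : IsStableEmbedding (f ∘ ι)) {κ : ℝ} (hκ : 1 ≤ κ) :
    ∃ R : ℝ, 0 ≤ R ∧ ∀ (s t : ℝ) (q : ℝ → P), ∀ a ∈ Set.range ι, ∀ b ∈ Set.range ι,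
      IsQuasigeodesicBetween κ s t q a b → ∃ η : ℝ → Y, ι (η s) = a ∧ ι (η t) = b ∧
        ∀ u ∈ Set.Icc s t, dist (q u) (ι (η u)) ≤ R := by
  obtain ⟨R, hR⟩ := exists_dist_le_of_isDiscreteQuasigeodesic hX hY hι hf hproper hφ
    (K := κ * κ + 1) (by nlinarith)
  refine ⟨max (2 * κ + R) 0, le_max_right _ _, fun s t q a ha b hb h => ?_⟩
  have hdisc := h.isDiscreteQuasigeodesic hκ
  obtain ⟨hst, rfl, rfl, hq⟩ := h
  have hnear : ∀ u ∈ Set.Icc s t, ∃ y, dist (q u) (ι y) ≤ 2 * κ + R := by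
    intro u hu
    have hus : 0 ≤ u - s := by linarith [hu.1]
    have hfl := Nat.floor_le hus
    have hfl' := Nat.lt_floor_add_one (u - s)
    obtain ⟨y, hy⟩ := hR _ _ (by simpa [hst] using ha)
      (by simpa [min_eq_right (by linarith [Nat.le_ceil (t - s)] : t ≤ s + (⌈t - s⌉₊ : ℝ))] using hb)
      hdisc ⌊u - s⌋₊ ((Nat.floor_le_floor (by linarith [hu.2])).trans (Nat.floor_le_ceil _))
    rw [min_eq_left (by linarith [hu.2])] at hy
    refine ⟨y, ?_⟩
    have h1 := (hq ⟨u, hu⟩ ⟨s + (⌊u - s⌋₊ : ℝ), by constructor <;> linarith [hu.2]⟩).2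
    rw [Subtype.dist_eq, Real.dist_eq, abs_of_nonneg (by linarith)] at h1
    simp only at h1
    have h2 : κ * (u - (s + (⌊u - s⌋₊ : ℝ))) ≤ κ * 1 :=
      mul_le_mul_of_nonneg_left (by linarith) (by linarith)
    linarith [dist_triangle (q u) (q (s + (⌊u - s⌋₊ : ℝ))) (ι y)]
  have hproj : ∀ u, ∃ y, (q u ∈ Set.range ι → ι y = q u) ∧
      (u ∈ Set.Icc s t → dist (q u) (ι y) ≤ max (2 * κ + R) 0) := by
    intro u
    by_cases hu : q u ∈ Set.range ι
    · obtain ⟨y, hy⟩ := hu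
      exact ⟨y, fun _ => hy, fun _ => by simp [hy]⟩
    · by_cases hu' : u ∈ Set.Icc s t
      · obtain ⟨y, hy⟩ := hnear u hu'
        exact ⟨y, fun h => absurd h hu, fun _ => hy.trans (le_max_left _ _)⟩
      · exact ⟨ha.choose, fun h => absurd h hu, fun h => absurd h hu'⟩
  choose η hη1 hη2 using hproj
  exact ⟨η, hη1 s ha, hη1 t hb, hη2⟩

/-- Stability pulls back along a Lipschitz map `f` under which points with nearby images are
close. -/
theorem isStableSubset_range_of_comp {Y P X : Type*} [MetricSpace Y] [MetricSpace P]
    [MetricSpace X] (hX : IsGeodesicMetricSpace X) (hY : IsDiscretelyGeodesic Y)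
    {ι : Y → P} {f : P → X} {A L : NNReal} (hι : LipschitzWith A ι) (hf : LipschitzWith L f)
    (hproper : ∀ C : ℝ, ∃ F : ℝ, ∀ p q : P, dist (f p) (f q) ≤ C → dist p q ≤ F)
    (hφ : IsStableEmbedding (f ∘ ι)) : IsStableSubset (Set.range ι) := by
  intro κ hκ
  obtain ⟨κ₀, lam, hκ₀, hlam, hqi⟩ := hφ.1
  obtain ⟨R, hR0, hR⟩ :=
    exists_projection_of_isQuasigeodesicBetween hX hY hι hf hproper hφ hκ.le
  set K : ℝ := 2 + L * κ + L * (κ + 2 * R) + κ * (A * κ₀) + κ * (2 * R + A * (κ₀ * lam) + κ)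
    with hK
  have hk1 : 0 ≤ L * κ := by positivity
  have hk2 : 0 ≤ L * (κ + 2 * R) := by positivity
  have hk3 : 0 ≤ κ * (A * κ₀) := by positivity
  have hk4 : 0 ≤ κ * (2 * R + A * (κ₀ * lam) + κ) := by positivity
  obtain ⟨D, hD, hstab⟩ := hφ.2 K (by linarith)
  obtain ⟨F, hF⟩ := hproper D
  -- The projection to the range of `ι` of a quasigeodesic becomes a quasigeodesic in `X`.
  have hqg : ∀ (s t : ℝ) (q : ℝ → P) (a b : P) (η : ℝ → Y),
      IsQuasigeodesicBetween κ s t q a b → ι (η s) = a → ι (η t) = b →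
      (∀ u ∈ Set.Icc s t, dist (q u) (ι (η u)) ≤ R) →
      IsQuasigeodesicBetween K s t (fun u => f (ι (η u))) (f a) (f b) := by
    intro s t q a b η hq ha hb hη
    refine ⟨hq.1, by simp only [ha], by simp only [hb],
      isQIEmbeddingWith_of_le (by linarith) fun u v => ?_⟩
    have h1 := (hq.2.2.2 u v).2
    have h2 := hq.2.2.2.dist_le hκ.le u v
    have h3 := hη u u.2
    have h4 := hη v v.2
    simp only at h1 h2 ⊢
    have h5 := dist_triangle4 (q u) (ι (η u)) (ι (η v)) (q v)
    have h6 := dist_triangle4 (ι (η u)) (q u) (q v) (ι (η v))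
    rw [dist_comm (ι (η v))] at h5
    rw [dist_comm (ι (η u)) (q u)] at h6
    have hduv : 0 ≤ dist u v := dist_nonneg
    constructor
    · have h7 := hf.dist_le_mul (ι (η u)) (ι (η v))
      have h8 : (L : ℝ) * dist (ι (η u)) (ι (η v)) ≤ L * (κ * dist u v + (κ + 2 * R)) :=
        mul_le_mul_of_nonneg_left (by linarith) L.coe_nonneg
      have h9 : L * κ * dist u v ≤ K * dist u v :=
        mul_le_mul_of_nonneg_right (by linarith) hduv
      linarith
    · have h7 := hι.dist_le_mul (η u) (η v)
      have h8 := mul_le_mul_of_nonneg_left (hqi.dist_le hκ₀ (η u) (η v)) A.coe_nonneg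
      simp only [Function.comp] at h8
      have h9 : dist u v ≤ κ * (2 * R + A * (κ₀ * (dist (f (ι (η u))) (f (ι (η v))) + lam)) + κ) :=
        h2.trans (mul_le_mul_of_nonneg_left (by linarith) (by linarith))
      have h10 : κ * (A * κ₀) * dist (f (ι (η u))) (f (ι (η v))) ≤
          K * dist (f (ι (η u))) (f (ι (η v))) :=
        mul_le_mul_of_nonneg_right (by linarith) dist_nonneg
      have h11 : K ≤ K * K := by nlinarith
      linarith
  have hsub : ∀ a ∈ Set.range ι, ∀ b ∈ Set.range ι, ∀ (s t : ℝ) (q : ℝ → P) (s' t' : ℝ)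
      (q' : ℝ → P), IsQuasigeodesicBetween κ s t q a b → IsQuasigeodesicBetween κ s' t' q' a b →
      q '' Set.Icc s t ⊆ Metric.thickening (2 * R + max F 0 + 1) (q' '' Set.Icc s' t') := by
    rintro a ha b hb s t q s' t' q' hq hq' _ ⟨u, hu, rfl⟩
    obtain ⟨η, hηa, hηb, hη⟩ := hR s t q a ha b hb hq
    obtain ⟨η', hηa', hηb', hη'⟩ := hR s' t' q' a ha b hb hq'
    have hfa : f a ∈ Set.range (f ∘ ι) := ⟨η s, congrArg f hηa⟩
    have hfb : f b ∈ Set.range (f ∘ ι) := ⟨η t, congrArg f hηb⟩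
    have h := (hstab _ hfa _ hfb _ _ _ _ _ _ (hqg s t q a b η hq hηa hηb hη)
      (hqg s' t' q' a b η' hq' hηa' hηb' hη')).1
    obtain ⟨_, ⟨v, hv, rfl⟩, hlt⟩ := Metric.mem_thickening_iff.mp (h ⟨u, hu, rfl⟩)
    refine Metric.mem_thickening_iff.mpr ⟨q' v, ⟨v, hv, rfl⟩, ?_⟩
    have h1 := (hF _ _ hlt.le).trans (le_max_left F 0)
    have h2 := dist_triangle4 (q u) (ι (η u)) (ι (η' v)) (q' v)
    rw [dist_comm (ι (η' v))] at h2
    linarith [hη u hu, hη' v hv]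
  have hF0 : 0 ≤ max F 0 := le_max_right _ _
  exact ⟨2 * R + max F 0 + 1, by linarith, fun a ha b hb s t q s' t' q' hq hq' =>
    ⟨hsub a ha b hb s t q s' t' q' hq hq', hsub a ha b hb s' t' q' s t q hq' hq⟩⟩

theorem isQIEmbedding_of_comp {Y P X : Type*} [MetricSpace Y] [MetricSpace P] [MetricSpace X]
    {ι : Y → P} {f : P → X} {A L : NNReal} (hι : LipschitzWith A ι) (hf : LipschitzWith L f)
    (hφ : IsQIEmbedding (f ∘ ι)) : IsQIEmbedding ι := by
  obtain ⟨κ, lam, hκ, hlam, hqi⟩ := hφ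
  set K : ℝ := 1 + A + κ * L + κ * lam with hK
  have hk1 : 0 ≤ κ * L := by positivity
  have hk2 : 0 ≤ κ * lam := by positivity
  have hA : (0 : ℝ) ≤ A := A.coe_nonneg
  refine ⟨K, K, by linarith, by linarith, isQIEmbeddingWith_of_le (by linarith) fun a b => ?_⟩
  have h1 := hι.dist_le_mul a b
  have h2 := hqi.dist_le hκ a b
  have h3 := hf.dist_le_mul (ι a) (ι b)
  have h4 : κ * (dist (f (ι a)) (f (ι b)) + lam) ≤ κ * (L * dist (ι a) (ι b) + lam) :=
    mul_le_mul_of_nonneg_left (by linarith) (by linarith)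
  have h5 : A * dist a b ≤ K * dist a b := mul_le_mul_of_nonneg_right (by linarith) dist_nonneg
  have h6 : κ * L * dist (ι a) (ι b) ≤ K * dist (ι a) (ι b) :=
    mul_le_mul_of_nonneg_right (by linarith) dist_nonneg
  have h7 : K ≤ K * K := by nlinarith
  simp only [Function.comp] at h2
  exact ⟨by linarith, by linarith⟩

/-! ### Word metrics and orbit maps -/

theorem dist_wordMetric {G : Type*} [Group G] (S : FiniteGeneratingSet G)
    (g h : WordMetricSpace S) :
    dist g h = (wordNorm S ((ofWordMetric S g)⁻¹ * ofWordMetric S h) : ℝ) :=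
  rfl

/-- The prefixes of a shortest word form a geodesic. -/
theorem isDiscretelyGeodesic_wordMetric {G : Type*} [Group G] (S : FiniteGeneratingSet G) :
    IsDiscretelyGeodesic (WordMetricSpace S) := by
  intro a b
  obtain ⟨l, ⟨hl, hprod⟩, hlen⟩ :=
    exists_word_length_eq_wordNorm S ((ofWordMetric S a)⁻¹ * ofWordMetric S b)
  set y : ℕ → WordMetricSpace S := fun i => toWordMetric S (ofWordMetric S a * (l.take i).prod)
    with hy
  have hy0 : y 0 = a := by
    simp only [hy, List.take_zero, List.prod_nil, mul_one]
    rfl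
  have hyn : y l.length = b := by
    simp only [hy, List.take_length, hprod, mul_inv_cancel_left]
    rfl
  have hle : ∀ i j, i ≤ j → dist (y i) (y j) ≤ (j : ℝ) - i := by
    intro i j hij
    have h1 : (l.take j).prod = (l.take i).prod * ((l.drop i).take (j - i)).prod := by
      rw [← List.prod_append, ← List.take_add, Nat.add_sub_cancel' hij]
    have h2 : IsWordFor S ((ofWordMetric S (y i))⁻¹ * ofWordMetric S (y j))
        ((l.drop i).take (j - i)) := by
      refine ⟨fun c hc => hl c (List.mem_of_mem_drop (List.mem_of_mem_take hc)), ?_⟩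
      change _ = (ofWordMetric S a * (l.take i).prod)⁻¹ * (ofWordMetric S a * (l.take j).prod)
      rw [h1]
      group
    have h3 := (wordNorm_le_length h2).trans (List.length_take_le _ _)
    rw [dist_wordMetric, ← Nat.cast_sub hij]
    exact_mod_cast h3
  refine ⟨l.length, y, hy0, hyn, fun i j hij hj => le_antisymm (hle i j hij) ?_⟩
  have h1 := dist_triangle4 (y 0) (y i) (y j) (y l.length)
  have h2 : dist (y 0) (y l.length) = l.length := by
    rw [hy0, hyn, dist_wordMetric, hlen]
  have h3 := hle 0 i (Nat.zero_le i)
  have h4 := hle j l.length hj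
  push_cast at h3
  linarith

/-- The word norm dominates every symmetric subadditive function, up to a constant. -/
theorem exists_le_mul_wordNorm {G : Type*} [Group G] (S : FiniteGeneratingSet G) (N : G → ℝ)
    (h0 : ∀ g, 0 ≤ N g) (h1 : N 1 = 0) (hmul : ∀ g h, N (g * h) ≤ N g + N h)
    (hinv : ∀ g, N g⁻¹ = N g) : ∃ L : NNReal, ∀ g, N g ≤ L * wordNorm S g := by
  refine ⟨.mk (∑ s ∈ S.carrier, N s) (Finset.sum_nonneg fun s _ => h0 s), fun g => ?_⟩
  obtain ⟨l, ⟨hl, rfl⟩, hlen⟩ := exists_word_length_eq_wordNorm S g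
  rw [← hlen, NNReal.coe_mk]
  clear hlen
  induction l with
  | nil => simp [h1]
  | cons a l ih =>
    have h2 := ih fun b hb => hl b (List.mem_cons_of_mem a hb)
    have h3 : N a ≤ ∑ s ∈ S.carrier, N s := by
      rcases hl a List.mem_cons_self with ha | ha
      · exact Finset.single_le_sum (fun s _ => h0 s) ha
      · rw [← hinv a]
        exact Finset.single_le_sum (f := N) (fun s _ => h0 s) ha
    rw [List.prod_cons, List.length_cons]
    push_cast
    linarith [hmul a l.prod]

theorem dist_smul_smul_eq {G X : Type*} [Group G] [MetricSpace X] [MulAction G X]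
    [IsIsometricSMul G X] (g h : G) (x : X) : dist (g • x) (h • x) = dist x ((g⁻¹ * h) • x) := by
  rw [← dist_smul g x, smul_smul, mul_inv_cancel_left]

theorem exists_lipschitzWith_orbitMap {G X : Type*} [Group G] [MetricSpace X] [MulAction G X]
    [IsIsometricSMul G X] (S : FiniteGeneratingSet G) (x : X) :
    ∃ L : NNReal, LipschitzWith L (fun g : WordMetricSpace S => ofWordMetric S g • x) := by
  obtain ⟨L, hL⟩ := exists_le_mul_wordNorm S (fun g => dist x (g • x)) (fun _ => dist_nonneg)
    (by simp) (fun g h => by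
      have h1 := dist_triangle x (g • x) ((g * h) • x)
      rwa [dist_smul_smul_eq g, inv_mul_cancel_left] at h1)
    (fun g => by
      have h1 := dist_smul_smul_eq g 1 x
      rw [one_smul, mul_one] at h1
      rw [← h1, dist_comm])
  exact ⟨L, LipschitzWith.of_dist_le_mul fun g h => by
    rw [dist_smul_smul_eq]
    exact hL _⟩

/-- Homomorphisms are Lipschitz for word metrics. -/
theorem exists_lipschitzWith_of_monoidHom {G H : Type*} [Group G] [Group H] (ψ : H →* G)
    (T : FiniteGeneratingSet H) (S : FiniteGeneratingSet G) :
    ∃ A : NNReal, LipschitzWith A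
      (fun h : WordMetricSpace T => toWordMetric S (ψ (ofWordMetric T h))) := by
  obtain ⟨A, hA⟩ := exists_le_mul_wordNorm T (fun h => (wordNorm S (ψ h) : ℝ))
    (fun _ => Nat.cast_nonneg _) (by simp [wordNorm_one])
    (fun g h => by
      rw [map_mul]
      exact_mod_cast wordNorm_mul_le S (ψ g) (ψ h))
    (fun g => by rw [map_inv, wordNorm_inv])
  refine ⟨A, LipschitzWith.of_dist_le_mul fun g h => ?_⟩
  have h1 := hA ((ofWordMetric T g)⁻¹ * ofWordMetric T h)
  rw [map_mul, map_inv] at h1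
  exact h1

/-- The orbit map of a proper action is uniformly proper. -/
theorem IsProperAction.exists_dist_le {G X : Type*} [Group G] [MetricSpace X] [ProperSpace X]
    [MulAction G X] [IsIsometricSMul G X] (h : IsProperAction G X) (S : FiniteGeneratingSet G)
    (x : X) (C : ℝ) : ∃ F : ℝ, ∀ p q : WordMetricSpace S,
      dist (ofWordMetric S p • x) (ofWordMetric S q • x) ≤ C → dist p q ≤ F := by
  obtain ⟨F, hF⟩ := ((h _ (isCompact_closedBall x C)).image (wordNorm S)).bddAbove
  refine ⟨F, fun p q hpq => ?_⟩
  rw [dist_smul_smul_eq] at hpq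
  rw [dist_wordMetric]
  refine Nat.cast_le.mpr (hF ⟨_, ⟨((ofWordMetric S p)⁻¹ * ofWordMetric S q) • x,
    ⟨x, Metric.mem_closedBall_self (dist_nonneg.trans hpq), rfl⟩, ?_⟩, rfl⟩)
  rwa [Metric.mem_closedBall, dist_comm]

/-- Whether the orbit map of a subgroup is a stable embedding does not depend on the generating
set: the image does not, and word metrics of two finite generating sets are bi-Lipschitz
equivalent. -/
theorem IsStableEmbedding.orbitMapOn_of_orbitMapOn {G X : Type*} [Group G] [MetricSpace X]
    [MulAction G X] [IsIsometricSMul G X] {H : Subgroup G} {T : FiniteGeneratingSet H} {x : X}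
    (h : IsStableEmbedding (orbitMapOn H T x)) (T' : FiniteGeneratingSet H) :
    IsStableEmbedding (orbitMapOn H T' x) := by
  refine ⟨?_, h.2⟩
  obtain ⟨κ, lam, hκ, hlam, hqi⟩ := h.1
  obtain ⟨L, hL⟩ := exists_lipschitzWith_of_monoidHom (MonoidHom.id H) T T'
  have : IsIsometricSMul H X := ⟨fun h => isometry_smul X (h : G)⟩
  obtain ⟨L', hL'⟩ := exists_lipschitzWith_orbitMap (X := X) T' x
  have hL0 : (0 : ℝ) ≤ L := L.coe_nonneg
  have hL0' : (0 : ℝ) ≤ L' := L'.coe_nonneg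
  have hk1 : 0 ≤ L * κ := by positivity
  have hk2 : 0 ≤ L * (κ * lam) := by positivity
  set K : ℝ := 1 + L' + L * κ + L * (κ * lam) with hK
  refine ⟨K, K, by linarith, by linarith, isQIEmbeddingWith_of_le (by linarith) fun a b => ?_⟩
  have h1 : dist (orbitMapOn H T' x a) (orbitMapOn H T' x b) ≤ L' * dist a b :=
    hL'.dist_le_mul a b
  have h2 : dist a b ≤ L * dist (toWordMetric T (ofWordMetric T' a))
      (toWordMetric T (ofWordMetric T' b)) :=
    hL.dist_le_mul (toWordMetric T (ofWordMetric T' a)) (toWordMetric T (ofWordMetric T' b))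
  have h3 : dist (toWordMetric T (ofWordMetric T' a)) (toWordMetric T (ofWordMetric T' b)) ≤
      κ * (dist (orbitMapOn H T' x a) (orbitMapOn H T' x b) + lam) :=
    hqi.dist_le hκ (toWordMetric T (ofWordMetric T' a)) (toWordMetric T (ofWordMetric T' b))
  have h4 := mul_le_mul_of_nonneg_left h3 hL0
  have h5 : L' * dist a b ≤ K * dist a b := mul_le_mul_of_nonneg_right (by linarith) dist_nonneg
  have h6 : L * κ * dist (orbitMapOn H T' x a) (orbitMapOn H T' x b) ≤
      K * dist (orbitMapOn H T' x a) (orbitMapOn H T' x b) :=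
    mul_le_mul_of_nonneg_right (by linarith) dist_nonneg
  have h7 : K ≤ K * K := by nlinarith
  exact ⟨by linarith, by linarith⟩

theorem theorem4p1 {G X : Type*} [Group G] [Group.FG G]
    [MetricSpace X] [ProperSpace X] (hX : IsGeodesicMetricSpace X)
    [MulAction G X] [IsIsometricSMul G X] (hGX : IsProperAction G X)
    (H : Subgroup G)
    (hH : ∃ (x : X) (T : FiniteGeneratingSet H), IsStableEmbedding (orbitMapOn H T x)) :
    IsStableSubgroup H := by
  obtain ⟨x, T₀, h₀⟩ := hH
  refine ⟨(Group.fg_iff_subgroup_fg H).mp ⟨⟨T₀.carrier, T₀.closure_eq_top⟩⟩, fun S T => ?_⟩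
  have hT : IsStableEmbedding
      ((fun g : WordMetricSpace S => ofWordMetric S g • x) ∘ inclusionOn H T S) :=
    h₀.orbitMapOn_of_orbitMapOn T
  obtain ⟨A, hA⟩ := exists_lipschitzWith_of_monoidHom H.subtype T S
  obtain ⟨L, hL⟩ := exists_lipschitzWith_orbitMap (X := X) S x
  have hι : LipschitzWith A (inclusionOn H T S) := hA
  refine ⟨isQIEmbedding_of_comp hι hL hT.1, ?_⟩
  have hrange : toWordMetric S '' (H : Set G) = Set.range (inclusionOn H T S) := by
    ext g
    constructor
    · rintro ⟨h, hh, rfl⟩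
      exact ⟨toWordMetric T ⟨h, hh⟩, rfl⟩
    · rintro ⟨h, rfl⟩
      exact ⟨_, (ofWordMetric T h).2, rfl⟩
  rw [hrange]
  exact isStableSubset_range_of_comp hX (isDiscretelyGeodesic_wordMetric T) hι hL
    (hGX.exists_dist_le S x) hT
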